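/- Let $\mathbb F$ be a field and let $q\in\mathbb F$ be nonzero and not a root of unity. For $n\in\mathbb Z$ put $[n]_q=(q^n-q^{-n})/(q-q^{-1})$. Let $\mathbb V$ be the $\mathbb F$-vector space with basis the words in two letters $x,y$ (including the trivial word $1$), i.e. the free algebra on $x,y$. Put $\langle x,x\rangle=\langle y,y\rangle=2$ and $\langle x,y\rangle=\langle y,x\rangle=-2$. The $q$-shuffle algebra is $\mathbb V$ with the bilinear associative product $\star$ that has unit $1$ and satisfies, for nontrivial words $u=u_1\cdots u_r$ and $v=v_1\cdots v_s$, $$u\star v=u_1\bigl((u_2\cdots u_r)\star v\bigr)+q^{\langle u_1,v_1\rangle+\cdots+\langle u_r,v_1\rangle}\,v_1\bigl(u\star(v_2\cdots v_s)\bigr).$$ Put $\overline x=1$ and $\overline y=-1$. A word $v_1\cdots v_m$ is Catalan if $\overline v_1+\cdots+\overline v_i$ is nonnegative for $1\le i\le m-1$ and zero for $i=m$. For $n\in\mathbb N=\{0,1,2,\ldots\}$ define the following elements of $\mathbb V$: - $C_n=\sum v_1v_2\cdots v_{2n}\,[1]_q[1+\overline v_1]_q[1+\overline v_1+\overline v_2]_q\cdots[1+\overline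 v_1+\cdots+\overline v_{2n}]_q$, where the sum is over all Catalan words $v_1\cdots v_{2n}$ of length $2n$; - $\tilde G_n=xyxy\cdots xy$, the alternating word of length $2n$ that starts with $x$ (so $\tilde G_0=1$); - $D_n$, determined recursively by $D_0=1$ and $D_0\star\tilde G_n+D_1\star\tilde G_{n-1}+\cdots+D_n\star\tilde G_0=0$ for $n\ge1$. Then: 1. For every $n\in\mathbb N$, $$0=\sum_{i=0}^n(-1)^i[2n-i]_q\,C_i\star\tilde G_{n-i}.$$ 2. The following three (unital) subalgebras of the $q$-shuffle algebra $\mathbb V$ coincide: the one generated by $\{C_n\}_{n=1}^\infty$, the one generated by $\{D_n\}_{n=1}^\infty$, and the one generated by $\{\tilde G_n\}_{n=1}^\infty$. -/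

import Mathlib

/-- The two letters `x`, `y`. -/
inductive Letter : Type
  | x : Letter
  | y : Letter
  deriving DecidableEq

namespace Letter

instance : Fintype Letter := ⟨{x, y}, fun a => by cases a <;> simp⟩

/-- The symmetric form on letters: `⟨u, v⟩ = 2` if `u = v`, and `-2` otherwise. -/
def pairing (u v : Letter) : ℤ := if u = v then 2 else -2

/-- The weights `x̄ = 1` and `ȳ = -1`. -/
def bar : Letter → ℤ
  | x => 1
  | y => -1

end Letter

/-- For a word `u = u₁ ⋯ u_r` and a letter `v`, the integer `⟨u₁, v⟩ + ⋯ + ⟨u_r, v⟩`. -/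
def wordPairing (u : List Letter) (v : Letter) : ℤ :=
  (u.map fun a => Letter.pairing a v).sum

/-- The vector space `𝕍` over `F` with basis the words in `x, y` (the underlying space of the free
algebra on `x, y`). It is tagged with `q`, since it will carry the `q`-shuffle product. -/
def QShuffle (F : Type*) [Field F] (_q : Fˣ) : Type _ := List Letter →₀ F

namespace QShuffle

section Product

variable {F : Type*} [Field F] (q : Fˣ)

noncomputable instance : AddCommGroup (QShuffle F q) :=
  inferInstanceAs (AddCommGroup (List Letter →₀ F))

noncomputable instance : Module F (QShuffle F q) :=
  inferInstanceAs (Module F (List Letter →₀ F))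

/-- A word, as an element of `𝕍`. -/
noncomputable def word (w : List Letter) : QShuffle F q := Finsupp.single w (1 : F)

/-- The linear map of `𝕍` determined by its values on the basis of words. -/
noncomputable def extend {M : Type*} [AddCommGroup M] [Module F M] (f : List Letter → M) :
    QShuffle F q →ₗ[F] M :=
  Finsupp.lift M F (List Letter) f

/-- The linear map `w ↦ a w` of `𝕍` that puts the letter `a` in front of each word. -/
noncomputable def prepend (a : Letter) : QShuffle F q →ₗ[F] QShuffle F q :=
  extend q fun w => word q (a :: w)

/-- The `q`-shuffle product of two words. The trivial word is the unit, and
`u ⋆ v = u₁((u₂ ⋯ u_r) ⋆ v) + q ^ (⟨u₁, v₁⟩ + ⋯ + ⟨u_r, v₁⟩) v₁(u ⋆ (v₂ ⋯ v_s))`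
for nontrivial words `u = u₁ ⋯ u_r` and `v = v₁ ⋯ v_s`. -/
noncomputable def wordMul : List Letter → List Letter → QShuffle F q
  | [], v => word q v
  | a :: u, [] => word q (a :: u)
  | a :: u, b :: v =>
      prepend q a (wordMul u (b :: v)) +
        ((q ^ wordPairing (a :: u) b : Fˣ) : F) • prepend q b (wordMul (a :: u) v)
  termination_by u v => u.length + v.length

/-- The `q`-shuffle product on `𝕍`, as a bilinear map. -/
noncomputable def mulHom : QShuffle F q →ₗ[F] QShuffle F q →ₗ[F] QShuffle F q :=
  extend q fun u => extend q fun v => wordMul q u v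

variable {q} in
theorem hom_ext {M : Type*} [AddCommGroup M] [Module F M] {f g : QShuffle F q →ₗ[F] M}
    (h : ∀ w, f (word q w) = g (word q w)) : f = g :=
  Finsupp.lhom_ext' fun w => LinearMap.ext_ring (h w)

@[simp] theorem extend_word {M : Type*} [AddCommGroup M] [Module F M] (f : List Letter → M)
    (w : List Letter) : extend q f (word q w) = f w := by
  unfold extend word
  erw [Finsupp.lift_apply]
  rw [Finsupp.sum_single_index] <;> simp

@[simp] theorem prepend_word (a : Letter) (w : List Letter) :
    prepend q a (word q w) = word q (a :: w) := by
  simp [prepend]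

@[simp] theorem mulHom_word (u v : List Letter) :
    mulHom q (word q u) (word q v) = wordMul q u v := by
  simp [mulHom]

theorem wordMul_nil_left (v : List Letter) : wordMul q [] v = word q v := by
  rw [wordMul]

theorem wordMul_nil_right (u : List Letter) : wordMul q u [] = word q u := by
  cases u <;> rw [wordMul]

/-- The operator that multiplies a word `w` by `q` to the power `⟨w, c⟩`. -/
noncomputable def twist (c : Letter) : QShuffle F q →ₗ[F] QShuffle F q :=
  extend q fun w => ((q ^ wordPairing w c : Fˣ) : F) • word q w

theorem twist_prepend (c a : Letter) (f : QShuffle F q) :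
    twist q c (prepend q a f) =
      ((q ^ Letter.pairing a c : Fˣ) : F) • prepend q a (twist q c f) := by
  have : (twist q c) ∘ₗ (prepend q a) =
      ((q ^ Letter.pairing a c : Fˣ) : F) • ((prepend q a) ∘ₗ (twist q c)) := by
    apply hom_ext
    intro w
    simp [twist, wordPairing, zpow_add₀, smul_smul]
  exact LinearMap.congr_fun this f

theorem twist_wordMul (c : Letter) : ∀ u v : List Letter,
    twist q c (wordMul q u v) =
      (((q ^ wordPairing u c : Fˣ) : F) * ((q ^ wordPairing v c : Fˣ) : F)) • wordMul q u v
  | [], v => by simp [wordMul_nil_left, twist, wordPairing]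
  | a :: u, [] => by simp [wordMul_nil_right, twist, wordPairing]
  | a :: u, b :: v => by
      have h1 := twist_wordMul c u (b :: v)
      have h2 := twist_wordMul c (a :: u) v
      rw [wordMul, map_add, map_smul, twist_prepend, twist_prepend, h1, h2]
      simp only [wordPairing, List.map_cons, List.sum_cons, zpow_add, Units.val_mul, map_smul,
        smul_smul, smul_add]
      congr 2 <;> ring
  termination_by u v => u.length + v.length

/-- The defining recursion, with arbitrary elements in place of the tails of the words. -/
theorem mulHom_prepend_prepend (a b : Letter) (f g : QShuffle F q) :
    mulHom q (prepend q a f) (prepend q b g) =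
      prepend q a (mulHom q f (prepend q b g)) +
        prepend q b (mulHom q (twist q b (prepend q a f)) g) := by
  have : (mulHom q).compl₁₂ (prepend q a) (prepend q b) =
      ((mulHom q).compl₁₂ LinearMap.id (prepend q b)).compr₂ (prepend q a) +
        ((mulHom q).compl₁₂ ((twist q b) ∘ₗ (prepend q a)) LinearMap.id).compr₂
          (prepend q b) := by
    apply hom_ext
    intro u
    apply hom_ext
    intro v
    simp [twist, wordMul]
  exact LinearMap.congr_fun₂ this f g

theorem mulHom_nil_left (f : QShuffle F q) : mulHom q (word q []) f = f := by
  have : mulHom q (word q []) = LinearMap.id := by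
    apply hom_ext
    intro w
    simp [wordMul_nil_left]
  exact LinearMap.congr_fun this f

theorem mulHom_nil_right (f : QShuffle F q) : mulHom q f (word q []) = f := by
  have : (mulHom q).flip (word q []) = LinearMap.id := by
    apply hom_ext
    intro w
    simp [wordMul_nil_right]
  exact LinearMap.congr_fun this f

theorem mulHom_assoc_word : ∀ u v w : List Letter,
    mulHom q (mulHom q (word q u) (word q v)) (word q w) =
      mulHom q (word q u) (mulHom q (word q v) (word q w))
  | [], v, w => by rw [mulHom_nil_left, mulHom_nil_left]
  | a :: u, [], w => by rw [mulHom_nil_right, mulHom_nil_left]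
  | a :: u, b :: v, [] => by rw [mulHom_nil_right, mulHom_nil_right]
  | a :: u, b :: v, c :: w => by
      have h1 := mulHom_assoc_word u (b :: v) (c :: w)
      have h2 := mulHom_assoc_word (a :: u) v (c :: w)
      have h3 := mulHom_assoc_word (a :: u) (b :: v) w
      have t : ∀ (l : List Letter) (d : Letter), twist q d (word q l) =
          ((q ^ wordPairing l d : Fˣ) : F) • word q l := fun l d => by simp [twist]
      have hab : mulHom q (word q (a :: u)) (word q (b :: v)) =
          prepend q a (mulHom q (word q u) (word q (b :: v))) +
            ((q ^ wordPairing (a :: u) b : Fˣ) : F) •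
              prepend q b (mulHom q (word q (a :: u)) (word q v)) := by
        simp [wordMul]
      have hbc : mulHom q (word q (b :: v)) (word q (c :: w)) =
          prepend q b (mulHom q (word q v) (word q (c :: w))) +
            ((q ^ wordPairing (b :: v) c : Fˣ) : F) •
              prepend q c (mulHom q (word q (b :: v)) (word q w)) := by
        simp [wordMul]
      have htw : twist q c (mulHom q (word q (a :: u)) (word q (b :: v))) =
          (((q ^ wordPairing (a :: u) c : Fˣ) : F) * ((q ^ wordPairing (b :: v) c : Fˣ) : F)) •
            mulHom q (word q (a :: u)) (word q (b :: v)) := by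
        rw [mulHom_word, twist_wordMul]
      -- the left side
      have hL : mulHom q (mulHom q (word q (a :: u)) (word q (b :: v))) (word q (c :: w)) =
          prepend q a (mulHom q (mulHom q (word q u) (word q (b :: v))) (word q (c :: w))) +
          ((q ^ wordPairing (a :: u) b : Fˣ) : F) • prepend q b
            (mulHom q (mulHom q (word q (a :: u)) (word q v)) (word q (c :: w))) +
          (((q ^ wordPairing (a :: u) c : Fˣ) : F) * ((q ^ wordPairing (b :: v) c : Fˣ) : F)) •
            prepend q c
              (mulHom q (mulHom q (word q (a :: u)) (word q (b :: v))) (word q w)) := by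
        have e : prepend q c (mulHom q (twist q c
            (mulHom q (word q (a :: u)) (word q (b :: v)))) (word q w)) =
            (((q ^ wordPairing (a :: u) c : Fˣ) : F) *
              ((q ^ wordPairing (b :: v) c : Fˣ) : F)) • prepend q c
              (mulHom q (mulHom q (word q (a :: u)) (word q (b :: v))) (word q w)) := by
          rw [htw]
          simp only [map_smul, LinearMap.smul_apply]
        rw [← e, hab, ← prepend_word q c w]
        simp only [map_add, map_smul, LinearMap.add_apply, LinearMap.smul_apply,
          mulHom_prepend_prepend, smul_add]
        abel
      -- the right side
      have hR : mulHom q (word q (a :: u)) (mulHom q (word q (b :: v)) (word q (c :: w))) =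
          prepend q a (mulHom q (word q u) (mulHom q (word q (b :: v)) (word q (c :: w)))) +
          ((q ^ wordPairing (a :: u) b : Fˣ) : F) • prepend q b
            (mulHom q (word q (a :: u)) (mulHom q (word q v) (word q (c :: w)))) +
          (((q ^ wordPairing (a :: u) c : Fˣ) : F) * ((q ^ wordPairing (b :: v) c : Fˣ) : F)) •
            prepend q c
              (mulHom q (word q (a :: u)) (mulHom q (word q (b :: v)) (word q w))) := by
        rw [hbc]
        simp only [map_add, map_smul]
        rw [← prepend_word q a u, mulHom_prepend_prepend, mulHom_prepend_prepend]
        simp only [prepend_word, t, smul_add, map_smul, LinearMap.smul_apply, smul_smul]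
        rw [mul_comm ((q ^ wordPairing (b :: v) c : Fˣ) : F)]
        abel
      rw [hL, hR, h1, h2, h3]
  termination_by u v w => u.length + v.length + w.length

theorem induction_word {p : QShuffle F q → Prop} (f : QShuffle F q) (h0 : p 0)
    (hadd : ∀ f g, p f → p g → p (f + g)) (hw : ∀ (c : F) w, p (c • word q w)) : p f :=
  Finsupp.induction_linear (motive := p) f h0 hadd fun w c => by
    have h : c • word q w = (Finsupp.single w c : List Letter →₀ F) := by
      have := Finsupp.smul_single_one w c
      exact this
    exact h ▸ hw c w

theorem mulHom_assoc (f g h : QShuffle F q) :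
    mulHom q (mulHom q f g) h = mulHom q f (mulHom q g h) := by
  induction f using induction_word with
  | h0 => simp only [map_zero, LinearMap.zero_apply]
  | hadd f f' hf hf' => simp only [map_add, LinearMap.add_apply, hf, hf']
  | hw c u =>
    induction g using induction_word with
    | h0 => simp only [map_zero, LinearMap.zero_apply]
    | hadd g g' hg hg' => simp only [map_add, LinearMap.add_apply, hg, hg']
    | hw d v =>
      induction h using induction_word with
      | h0 => simp only [map_zero]
      | hadd h h' hh hh' => simp only [map_add, hh, hh']
      | hw e w => simp only [map_smul, LinearMap.smul_apply, mulHom_assoc_word]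

/-- The `q`-shuffle algebra: the space `𝕍` with the `q`-shuffle product as its multiplication and
the trivial word as its unit. -/
noncomputable instance : Ring (QShuffle F q) where
  __ := (inferInstance : AddCommGroup (QShuffle F q))
  mul f g := mulHom q f g
  one := word q []
  mul_assoc := mulHom_assoc q
  one_mul := mulHom_nil_left q
  mul_one := mulHom_nil_right q
  left_distrib f g h := map_add (mulHom q f) g h
  right_distrib f g h := LinearMap.map_add₂ (mulHom q) f g h
  zero_mul f := LinearMap.map_zero₂ (mulHom q) f
  mul_zero f := map_zero (mulHom q f)

noncomputable instance : Algebra F (QShuffle F q) :=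
  Algebra.ofModule (fun c f g => LinearMap.map_smul₂ (mulHom q) c f g)
    (fun c f g => map_smul (mulHom q f) c g)

theorem one_def : (1 : QShuffle F q) = word q [] := rfl

theorem word_mul_word (u v : List Letter) : word q u * word q v = wordMul q u v :=
  mulHom_word q u v

end Product

end QShuffle

/-- For a word `v₁ ⋯ v_n`, the integer `v̄₁ + ⋯ + v̄_i`. -/
def wordHeight (v : List Letter) (i : ℕ) : ℤ := ((v.take i).map Letter.bar).sum

/-- A word `v₁ ⋯ v_n` is Catalan if `v̄₁ + ⋯ + v̄_i` is nonnegative for `1 ≤ i ≤ n - 1` and zero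
for `i = n`. -/
def IsCatalan (v : List Letter) : Prop :=
  (∀ i, 1 ≤ i → i < v.length → 0 ≤ wordHeight v i) ∧ wordHeight v v.length = 0

section Elements

variable {F : Type*} [Field F] (q : Fˣ)

/-- `[n]_q = (q ^ n - q ^ (-n)) / (q - q⁻¹)`. -/
noncomputable def qInt (n : ℤ) : F :=
  ((q : F) ^ n - (q : F) ^ (-n)) / ((q : F) - (q : F)⁻¹)

open Classical in
/-- `C_n`, the sum over all Catalan words `v₁ ⋯ v_{2n}` of
`[1]_q [1 + v̄₁]_q [1 + v̄₁ + v̄₂]_q ⋯ [1 + v̄₁ + ⋯ + v̄_{2n}]_q v₁ ⋯ v_{2n}`. -/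
noncomputable def catalanElt (n : ℕ) : QShuffle F q :=
  ∑ v : Fin (2 * n) → Letter,
    if IsCatalan (List.ofFn v) then
      (∏ i ∈ Finset.range (2 * n + 1), qInt q (1 + wordHeight (List.ofFn v) i)) •
        QShuffle.word q (List.ofFn v)
    else 0

/-- The word `xyxy⋯xy` of length `2n`. -/
def altWord : ℕ → List Letter
  | 0 => []
  | n + 1 => Letter.x :: Letter.y :: altWord n

/-- The alternating word `G̃_n = xyxy⋯xy` of length `2n`, with `G̃_0 = 1`. -/
noncomputable def tildeG (n : ℕ) : QShuffle F q := QShuffle.word q (altWord n)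

/-- The elements `D_n`, determined by `D_0 = 1` and
`D_0 ⋆ G̃_n + D_1 ⋆ G̃_{n-1} + ⋯ + D_n ⋆ G̃_0 = 0` for `n ≥ 1`; as `G̃_0 = 1`, the latter equation
gives `D_n` in terms of `D_0, …, D_{n-1}`. -/
noncomputable def dElt : ℕ → QShuffle F q
  | 0 => 1
  | n + 1 => -∑ i : Fin (n + 1), dElt i * tildeG q (n + 1 - i)

/-- The recursion that defines the elements `D_n`. -/
theorem sum_dElt_mul_tildeG (n : ℕ) (hn : 1 ≤ n) :
    ∑ i ∈ Finset.range (n + 1), dElt q i * tildeG q (n - i) = 0 := by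
  obtain ⟨m, rfl⟩ := Nat.exists_eq_add_of_le' hn
  have h0 : tildeG q 0 = 1 := rfl
  rw [Finset.sum_range_succ, Nat.sub_self, h0, mul_one, dElt,
    Finset.sum_range fun i => dElt q i * tildeG q (m + 1 - i), add_neg_cancel]

end Elements

/-! Deleting a leading letter `a` is a twisted derivation of the `q`-shuffle product
(`deleteFirst_mul`). An element is determined by its constant term together with its two deletions,
so a family with zero constant terms, whose deletions stay in its own span, is zero
(`family_eq_zero`). Every product identity below is proved in this way.

The central identity, in generating functions, is `C(-qt) ⋆ G̃(q²t) = G̃(q⁻²t) ⋆ C(-q⁻¹t)`. Deletion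
turns Catalan words into words starting at another height `h`, and `xy⋯xy` into `yxy⋯xy`. Both sides
are therefore embedded in families indexed by `h` that obey the same deletion rules and have the
same constant terms, hence agree (`leftFamily_eq_rightFamily`).

In degree `n` the identity isolates `C_n` with coefficient `±(q^n - q^(-n))`, which is nonzero, so
by induction each `C_n` is a polynomial in the `G̃_k`. The `G̃_k` commute (`tildeG_commute`), hence
the `C_i` commute with them, and the two sides combine into the relation with coefficients `[2n -
i]_q`. There `G̃_n` has coefficient `[2n]_q ≠ 0`, so it can be solved for `G̃_n`. The recursion for
`D_n` is unitriangular and can be solved either way. -/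

namespace QShuffle

variable {F : Type*} [Field F] (q : Fˣ)

/-! ### Deletion of first letters and the vanishing criterion -/

/-- The linear map that deletes the first letter of each word starting with `a` and kills the
other words. -/
noncomputable def deleteFirst (a : Letter) : QShuffle F q →ₗ[F] QShuffle F q :=
  extend q fun w => match w with
    | [] => 0
    | b :: w => if b = a then word q w else 0

/-- The coefficient of a word. -/
noncomputable def wordCoeff (w : List Letter) : QShuffle F q →ₗ[F] F :=
  extend q fun v => if v = w then 1 else 0

theorem wordCoeff_apply (w : List Letter) (f : QShuffle F q) :
    wordCoeff q w f = (show List Letter →₀ F from f) w := by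
  have : wordCoeff q w = (Finsupp.lapply w : (List Letter →₀ F) →ₗ[F] F) := by
    apply hom_ext
    intro v
    rw [wordCoeff, extend_word]
    exact (Finsupp.single_apply).symm
  exact LinearMap.congr_fun this f

theorem eq_zero_of_wordCoeff (f : QShuffle F q) (h : ∀ w, wordCoeff q w f = 0) : f = 0 :=
  Finsupp.ext fun w => (wordCoeff_apply q w f).symm.trans (h w)

@[simp] theorem deleteFirst_nil (a : Letter) : deleteFirst q a (word q []) = 0 := by
  simp [deleteFirst]

@[simp] theorem deleteFirst_one (a : Letter) : deleteFirst q a 1 = 0 :=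
  deleteFirst_nil q a

theorem deleteFirst_cons (a b : Letter) (w : List Letter) :
    deleteFirst q a (word q (b :: w)) = if b = a then word q w else 0 := by
  simp [deleteFirst]

theorem deleteFirst_prepend (a b : Letter) (f : QShuffle F q) :
    deleteFirst q a (prepend q b f) = if b = a then f else 0 := by
  have : deleteFirst q a ∘ₗ prepend q b = if b = a then LinearMap.id else 0 := by
    apply hom_ext
    intro w
    split_ifs with h <;> simp [deleteFirst_cons, h]
  have := LinearMap.congr_fun this f
  split_ifs with h <;> simpa [h] using this

theorem wordCoeff_cons (a : Letter) (w : List Letter) (f : QShuffle F q) :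
    wordCoeff q (a :: w) f = wordCoeff q w (deleteFirst q a f) := by
  have : wordCoeff q (a :: w) = wordCoeff q w ∘ₗ deleteFirst q a := by
    apply hom_ext
    rintro (_ | ⟨b, v⟩)
    · simp [wordCoeff]
    · by_cases h : b = a <;> simp [deleteFirst_cons, wordCoeff, h]
  exact LinearMap.congr_fun this f

theorem twist_word (c : Letter) (w : List Letter) :
    twist q c (word q w) = ((q ^ wordPairing w c : Fˣ) : F) • word q w := by
  simp [twist]

@[simp] theorem twist_one (c : Letter) : twist q c 1 = 1 := by
  rw [one_def, twist_word]
  simp [wordPairing]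

/-- Deletion of the first letter is a twisted derivation of the `q`-shuffle algebra. -/
theorem deleteFirst_mul (a : Letter) (f g : QShuffle F q) :
    deleteFirst q a (f * g) = deleteFirst q a f * g + twist q a f * deleteFirst q a g := by
  have : (mulHom q).compr₂ (deleteFirst q a) =
      (mulHom q).compl₁₂ (deleteFirst q a) LinearMap.id +
        (mulHom q).compl₁₂ (twist q a) (deleteFirst q a) := by
    apply hom_ext
    intro u
    apply hom_ext
    intro v
    rcases u with _ | ⟨b, u⟩
    · simp [wordMul_nil_left, twist, wordPairing, mulHom_nil_left]
    · rcases v with _ | ⟨c, v⟩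
      · simp [mulHom_nil_right]
      · simp only [LinearMap.compr₂_apply, LinearMap.add_apply, LinearMap.compl₁₂_apply,
          LinearMap.id_apply, mulHom_word, wordMul, map_add, map_smul, deleteFirst_prepend,
          deleteFirst_cons, twist_word, LinearMap.smul_apply]
        by_cases h1 : b = a <;> by_cases h2 : c = a <;> simp [h1, h2]
  exact LinearMap.congr_fun₂ this f g

theorem wordCoeff_nil_prepend (a : Letter) (f : QShuffle F q) :
    wordCoeff q [] (prepend q a f) = 0 := by
  have : wordCoeff q [] ∘ₗ prepend q a = 0 := by
    apply hom_ext
    intro w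
    simp [wordCoeff]
  exact LinearMap.congr_fun this f

/-- The constant term, as a ring homomorphism. -/
noncomputable def constTerm : QShuffle F q →+* F where
  toFun := wordCoeff q []
  map_zero' := map_zero _
  map_add' := map_add _
  map_one' := by simp [one_def, wordCoeff]
  map_mul' f g := by
    have : (mulHom q).compr₂ (wordCoeff q []) =
        (LinearMap.mul F F).compl₁₂ (wordCoeff q []) (wordCoeff q []) := by
      apply hom_ext
      intro u
      apply hom_ext
      intro v
      rcases u with _ | ⟨b, u⟩
      · simp [wordMul_nil_left, wordCoeff]
      · rcases v with _ | ⟨c, v⟩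
        · simp [wordMul_nil_right, wordCoeff]
        · simp only [LinearMap.compr₂_apply, LinearMap.compl₁₂_apply, mulHom_word, wordMul,
            map_add, map_smul, wordCoeff_nil_prepend]
          simp [wordCoeff]
    exact LinearMap.congr_fun₂ this f g

@[simp] theorem constTerm_smul (c : F) (f : QShuffle F q) :
    constTerm q (c • f) = c * constTerm q f :=
  map_smul (wordCoeff q []) c f

@[simp] theorem constTerm_prepend (a : Letter) (f : QShuffle F q) :
    constTerm q (prepend q a f) = 0 :=
  wordCoeff_nil_prepend q a f

/-- A subspace without constant terms that is stable under deletion of first letters is zero. -/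
theorem eq_zero_of_mem_stable (S : Submodule F (QShuffle F q))
    (h0 : ∀ f ∈ S, constTerm q f = 0) (hS : ∀ a, ∀ f ∈ S, deleteFirst q a f ∈ S)
    {f : QShuffle F q} (hf : f ∈ S) : f = 0 := by
  apply eq_zero_of_wordCoeff
  intro w
  induction w generalizing f with
  | nil => exact h0 f hf
  | cons a w ih => rw [wordCoeff_cons]; exact ih (hS a f hf)

/-- The vanishing criterion applied to a span: linearity reduces both conditions to the generators
`z i`. -/
theorem family_eq_zero {ι : Type*} (z : ι → QShuffle F q) (h0 : ∀ i, constTerm q (z i) = 0)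
    (hz : ∀ a i, deleteFirst q a (z i) ∈ Submodule.span F (Set.range z)) (i : ι) : z i = 0 := by
  refine eq_zero_of_mem_stable q (Submodule.span F (Set.range z)) ?_ ?_
    (Submodule.subset_span ⟨i, rfl⟩)
  · intro f hf
    have : Submodule.span F (Set.range z) ≤ LinearMap.ker (wordCoeff q []) := by
      rw [Submodule.span_le]
      rintro _ ⟨j, rfl⟩
      exact h0 j
    exact this hf
  · intro a f hf
    have : Submodule.span F (Set.range z) ≤
        (Submodule.span F (Set.range z)).comap (deleteFirst q a) := by
      rw [Submodule.span_le]
      rintro _ ⟨j, rfl⟩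
      exact hz a j
    exact this hf

/-! ### Alternating words -/

/-- The words `xyxy⋯xy`, indexed by the integers and zero for negative indices. -/
noncomputable def altXY (i : ℤ) : QShuffle F q := if 0 ≤ i then tildeG q i.toNat else 0

/-- The words `yxy⋯xy`, indexed by the integers and zero for negative indices. -/
noncomputable def altYXY (i : ℤ) : QShuffle F q := prepend q Letter.y (altXY q i)

@[simp] theorem altXY_natCast (n : ℕ) : altXY q n = tildeG q n := by simp [altXY]

theorem altXY_of_neg {i : ℤ} (h : i < 0) : altXY q i = 0 := by simp [altXY, h]

@[simp] theorem altYXY_of_neg {i : ℤ} (h : i < 0) : altYXY q i = 0 := by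
  simp [altYXY, altXY_of_neg q h]

@[simp] theorem tildeG_zero : tildeG q 0 = 1 := rfl

theorem tildeG_succ (n : ℕ) :
    tildeG q (n + 1) = prepend q Letter.x (prepend q Letter.y (tildeG q n)) := by
  simp [tildeG, altWord]

/-- Since negative indices give zero, one formula serves all integers, and the deletion rules need
no boundary cases. -/
theorem altXY_cases (i : ℤ) : altXY q i = (if i = 0 then 1 else 0) +
    prepend q Letter.x (altYXY q (i - 1)) := by
  rcases lt_or_ge i 0 with h | h
  · simp [altXY_of_neg q h, h.ne, altYXY_of_neg q (show i - 1 < 0 by omega)]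
  · obtain ⟨n, rfl⟩ := Int.eq_ofNat_of_zero_le h
    rcases n with _ | n
    · rw [altXY_natCast]
      simp
    · rw [altXY_natCast, tildeG_succ, altYXY]
      have : ((n + 1 : ℕ) : ℤ) - 1 = n := by push_cast; ring
      rw [this, altXY_natCast, if_neg (by omega), zero_add]

@[simp] theorem deleteFirst_x_altXY (i : ℤ) :
    deleteFirst q Letter.x (altXY q i) = altYXY q (i - 1) := by
  rw [altXY_cases, map_add, deleteFirst_prepend, if_pos rfl]
  split_ifs <;> simp

@[simp] theorem deleteFirst_y_altXY (i : ℤ) : deleteFirst q Letter.y (altXY q i) = 0 := by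
  rw [altXY_cases, map_add, deleteFirst_prepend]
  split_ifs <;> simp_all

@[simp] theorem deleteFirst_x_altYXY (i : ℤ) : deleteFirst q Letter.x (altYXY q i) = 0 := by
  simp [altYXY, deleteFirst_prepend]

@[simp] theorem deleteFirst_y_altYXY (i : ℤ) :
    deleteFirst q Letter.y (altYXY q i) = altXY q i := by
  simp [altYXY, deleteFirst_prepend]

-- Equally many `x` and `y` occur, so their pairings with `c` cancel.
@[simp] theorem twist_tildeG (c : Letter) (n : ℕ) : twist q c (tildeG q n) = tildeG q n := by
  induction n with
  | zero => simp
  | succ n ih =>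
    rw [tildeG_succ, twist_prepend, twist_prepend, ih, map_smul, smul_smul, ← Units.val_mul,
      ← zpow_add]
    cases c <;> simp [Letter.pairing]

@[simp] theorem twist_altXY (c : Letter) (i : ℤ) : twist q c (altXY q i) = altXY q i := by
  rw [altXY]
  split_ifs <;> simp

@[simp] theorem twist_altYXY (c : Letter) (i : ℤ) :
    twist q c (altYXY q i) = (q : F) ^ (-2 * c.bar) • altYXY q i := by
  rw [altYXY, twist_prepend, twist_altXY]
  cases c <;> simp [Letter.pairing, Letter.bar]

@[simp] theorem constTerm_altXY (i : ℤ) : constTerm q (altXY q i) = if i = 0 then 1 else 0 := by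
  rw [altXY_cases]
  split_ifs <;> simp

@[simp] theorem constTerm_altYXY (i : ℤ) : constTerm q (altYXY q i) = 0 := by
  simp [altYXY]

/-! ### Commutation of the alternating words -/

/-- Elements spanning a subspace that contains the commutators of the words `xyxy⋯xy` and is
stable under deletion of first letters. -/
noncomputable def commutatorFamily : Fin 4 × ℤ × ℤ → QShuffle F q
  | (0, i, j) => altXY q i * altXY q j - altXY q j * altXY q i
  | (1, i, j) => altYXY q (i - 1) * altXY q j + altXY q i * altYXY q (j - 1) -
      (altYXY q (j - 1) * altXY q i + altXY q j * altYXY q (i - 1))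
  | (2, i, j) => altYXY q i * altYXY q j - altYXY q j * altYXY q i
  | (3, i, j) => altXY q i * altYXY q j + (q : F) ^ (2 : ℤ) • (altYXY q i * altXY q j) -
      (altXY q j * altYXY q i + (q : F) ^ (2 : ℤ) • (altYXY q j * altXY q i))

/-- The four types are what repeated deletion produces from a commutator. Deleting `x` sends type 0
to 1, types 1 and 3 to 2, and kills 2; deleting `y` sends types 1 and 3 to 0, type 2 to 3, and kills
0. Constant terms vanish because `F` is commutative. -/
theorem commutatorFamily_eq_zero (k : Fin 4 × ℤ × ℤ) : commutatorFamily q k = 0 := by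
  have hq0 : (q : F) ≠ 0 := q.ne_zero
  apply family_eq_zero
  · rintro ⟨k, i, j⟩
    fin_cases k <;> simp [commutatorFamily, mul_comm]
  · have key : ∀ k, commutatorFamily q k ∈
        Submodule.span F (Set.range (commutatorFamily q)) :=
      fun k => Submodule.subset_span ⟨k, rfl⟩
    have hinv : (q : F) ^ (-2 : ℤ) * (q : F) ^ (2 : ℤ) = 1 := by
      rw [← zpow_add₀ hq0]; simp
    rintro a ⟨k, i, j⟩
    fin_cases k <;> cases a
    · convert key (1, i, j) using 1
      simp [commutatorFamily, deleteFirst_mul]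
    · convert Submodule.zero_mem _ using 1
      simp [commutatorFamily, deleteFirst_mul]
    · convert Submodule.smul_mem _ (1 + (q : F) ^ (-2 : ℤ)) (key (2, i - 1, j - 1)) using 1
      simp only [commutatorFamily, deleteFirst_mul, map_add, map_sub, deleteFirst_x_altXY,
        deleteFirst_x_altYXY, twist_altXY, twist_altYXY, Letter.bar, zero_mul, mul_zero,
        smul_mul_assoc, mul_one]
      module
    · convert Submodule.add_mem _ (key (0, i - 1, j)) (key (0, i, j - 1)) using 1
      simp only [commutatorFamily, deleteFirst_mul, map_add, map_sub, deleteFirst_y_altXY,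
        deleteFirst_y_altYXY, twist_altXY, twist_altYXY, Letter.bar, zero_mul, mul_zero]
      module
    · convert Submodule.zero_mem _ using 1
      simp [commutatorFamily, deleteFirst_mul]
    · convert key (3, i, j) using 1
      simp only [commutatorFamily, deleteFirst_mul, map_sub, deleteFirst_y_altYXY, twist_altYXY,
        Letter.bar, smul_mul_assoc]
      norm_num
    · convert Submodule.add_mem _ (key (2, i - 1, j)) (key (2, i, j - 1)) using 1
      simp only [commutatorFamily, deleteFirst_mul, map_add, map_sub, map_smul,
        deleteFirst_x_altXY, deleteFirst_x_altYXY, twist_altXY, twist_altYXY, Letter.bar,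
        zero_mul, mul_zero, smul_mul_assoc, smul_add, smul_smul, smul_zero, mul_one,
        mul_comm ((q : F) ^ (2 : ℤ)), hinv]
      module
    · convert Submodule.smul_mem _ (1 + (q : F) ^ (2 : ℤ)) (key (0, i, j)) using 1
      simp only [commutatorFamily, deleteFirst_mul, map_add, map_sub, map_smul,
        deleteFirst_y_altXY, deleteFirst_y_altYXY, twist_altXY, twist_altYXY, Letter.bar,
        zero_mul, mul_zero, smul_add, smul_zero]
      module

/-- The elements `G̃_n` mutually commute. -/
theorem tildeG_commute (m n : ℕ) : Commute (tildeG q m) (tildeG q n) := by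
  have := commutatorFamily_eq_zero q (0, m, n)
  simpa [commutatorFamily, sub_eq_zero, commute_iff_eq] using this

end QShuffle

section QInt

variable {F : Type*} [Field F] (q : Fˣ)

@[simp] theorem qInt_zero : qInt q 0 = 0 := by simp [qInt]

end QInt

namespace QShuffle

variable {F : Type*} [Field F] (q : Fˣ)

/-! ### Weighted words -/

/-- The sum of the words of length `m` that go from height `h` to height `0`, each weighted by the
product of `[1 + k]_q` over the heights `k` it attains before its end. -/
noncomputable def pathSum : ℕ → ℤ → QShuffle F q
  | 0, h => if h = 0 then 1 else 0
  | m + 1, h => qInt q (h + 1) •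
      (prepend q Letter.x (pathSum m (h + 1)) + prepend q Letter.y (pathSum m (h - 1)))

theorem pathSum_neg_one (m : ℕ) : pathSum q m (-1) = 0 := by
  cases m <;> simp [pathSum]

/-- The pairing of letters `a`, `c` is `2 * a.bar * c.bar`, and the weights `a.bar` of a word
descending from height `h` to `0` add up to `-h`. -/
theorem twist_pathSum (c : Letter) (m : ℕ) (h : ℤ) :
    twist q c (pathSum q m h) = (q : F) ^ (-2 * h * c.bar) • pathSum q m h := by
  have hq0 : (q : F) ≠ 0 := q.ne_zero
  induction m generalizing h with
  | zero =>
    rw [pathSum]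
    split_ifs with hh <;> simp [hh]
  | succ m ih =>
    have e1 : (q : F) ^ Letter.pairing Letter.x c * (q : F) ^ (-2 * (h + 1) * c.bar) =
        (q : F) ^ (-2 * h * c.bar) := by
      rw [← zpow_add₀ hq0]
      congr 1
      cases c <;> simp [Letter.pairing, Letter.bar] <;> ring
    have e2 : (q : F) ^ Letter.pairing Letter.y c * (q : F) ^ (-2 * (h - 1) * c.bar) =
        (q : F) ^ (-2 * h * c.bar) := by
      rw [← zpow_add₀ hq0]
      congr 1
      cases c <;> simp [Letter.pairing, Letter.bar] <;> ring
    rw [pathSum, map_smul, map_add, twist_prepend, twist_prepend, ih, ih, map_smul, map_smul,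
      smul_smul, smul_smul, Units.val_zpow_eq_zpow_val, Units.val_zpow_eq_zpow_val, e1, e2,
      ← smul_add, smul_comm]

/-- The weighted sum of the words with `n` letters `y` that go from height `h` to height `0`
and keep to nonnegative heights. -/
noncomputable def heightSum (h : ℤ) (n : ℕ) : QShuffle F q :=
  if 0 ≤ h ∧ h ≤ 2 * n then pathSum q (2 * n - h).toNat h else 0

/-- Height `-1` is admitted because its weight `[0]_q` is zero; a downward step from height `0` then
needs no separate treatment. -/
theorem heightSum_eq (h : ℤ) (n m : ℕ) (hm : 2 * (n : ℤ) - h = m) (hh : -1 ≤ h) :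
    heightSum q h n = pathSum q m h := by
  rw [heightSum]
  split_ifs with h1
  · rw [hm, Int.toNat_natCast]
  · obtain rfl : h = -1 := by omega
    rw [pathSum_neg_one]

theorem heightSum_of_neg {h : ℤ} (n : ℕ) (hh : h < 0) : heightSum q h n = 0 := by
  rw [heightSum, if_neg (by omega)]

theorem heightSum_of_lt {h : ℤ} (n : ℕ) (hh : 2 * n < h) : heightSum q h n = 0 := by
  rw [heightSum, if_neg (by omega)]

theorem heightSum_cases (h : ℤ) (n : ℕ) : heightSum q h n = (if h = 0 ∧ n = 0 then 1 else 0) +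
    qInt q (h + 1) • (prepend q Letter.x (heightSum q (h + 1) n) +
      prepend q Letter.y (if n = 0 then 0 else heightSum q (h - 1) (n - 1))) := by
  rcases lt_or_ge h 0 with h0 | h0
  · rw [heightSum_of_neg q n h0, if_neg (by omega)]
    rcases eq_or_ne h (-1) with rfl | h1
    · simp
    · rw [heightSum_of_neg q n (by omega), heightSum_of_neg q (n - 1) (by omega)]
      simp
  · rcases lt_trichotomy (2 * (n : ℤ)) h with h1 | h1 | h1
    · rw [heightSum_of_lt q n h1, heightSum_of_lt q n (by omega), if_neg (by omega)]
      rcases n with _ | n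
      · simp
      · rw [heightSum_of_lt q _ (by push_cast at h1 ⊢; omega)]
        simp
    · rw [heightSum_eq q h n 0 (by omega) (by omega), heightSum_of_lt q n (by omega), pathSum]
      rcases n with _ | n
      · simp [show h = 0 by simpa using h1.symm]
      · rw [heightSum_of_lt q _ (by push_cast at h1 ⊢; omega), if_neg (by omega),
          if_neg (by omega)]
        simp
    · obtain ⟨n, rfl⟩ : ∃ k, n = k + 1 := ⟨n - 1, by omega⟩
      obtain ⟨m, hm⟩ : ∃ m : ℕ, 2 * ((n + 1 : ℕ) : ℤ) - h = (m + 1 : ℕ) :=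
        ⟨(2 * ((n + 1 : ℕ) : ℤ) - h - 1).toNat, by omega⟩
      rw [heightSum_eq q h _ (m + 1) hm (by omega), pathSum,
        heightSum_eq q (h + 1) _ m (by omega) (by omega)]
      have : heightSum q (h - 1) (n + 1 - 1) = pathSum q m (h - 1) :=
        heightSum_eq q (h - 1) _ m (by push_cast at hm ⊢; omega) (by omega)
      rw [this]
      simp

@[simp] theorem deleteFirst_x_heightSum (h : ℤ) (n : ℕ) :
    deleteFirst q Letter.x (heightSum q h n) = qInt q (h + 1) • heightSum q (h + 1) n := by
  rw [heightSum_cases, map_add, map_smul, map_add, deleteFirst_prepend, deleteFirst_prepend]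
  split_ifs <;> simp_all

@[simp] theorem deleteFirst_y_heightSum_zero (h : ℤ) :
    deleteFirst q Letter.y (heightSum q h 0) = 0 := by
  rw [heightSum_cases, map_add, map_smul, map_add, deleteFirst_prepend, deleteFirst_prepend]
  split_ifs <;> simp_all

@[simp] theorem deleteFirst_y_heightSum_succ (h : ℤ) (n : ℕ) :
    deleteFirst q Letter.y (heightSum q h (n + 1)) =
      qInt q (h + 1) • heightSum q (h - 1) n := by
  rw [heightSum_cases, map_add, map_smul, map_add, deleteFirst_prepend, deleteFirst_prepend]
  simp

@[simp] theorem twist_heightSum (c : Letter) (h : ℤ) (n : ℕ) :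
    twist q c (heightSum q h n) = (q : F) ^ (-2 * h * c.bar) • heightSum q h n := by
  rw [heightSum]
  split_ifs
  · exact twist_pathSum q c _ h
  · simp

@[simp] theorem constTerm_heightSum (h : ℤ) (n : ℕ) :
    constTerm q (heightSum q h n) = if h = 0 ∧ n = 0 then 1 else 0 := by
  rw [heightSum_cases, map_add, constTerm_smul, map_add, constTerm_prepend, constTerm_prepend]
  split_ifs <;> simp

/-! ### Catalan words -/

theorem sum_fin_succ_letter {M : Type*} [AddCommMonoid M] (m : ℕ)
    (f : (Fin (m + 1) → Letter) → M) :
    ∑ v, f v = ∑ v : Fin m → Letter, f (Fin.cons Letter.x v) +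
      ∑ v : Fin m → Letter, f (Fin.cons Letter.y v) := by
  rw [← (Fin.consEquiv fun _ : Fin (m + 1) => Letter).sum_comp, Fintype.sum_prod_type]
  have : (Finset.univ : Finset Letter) = {Letter.x, Letter.y} := rfl
  rw [this, Finset.sum_pair (by decide)]
  rfl

theorem wordHeight_zero (v : List Letter) : wordHeight v 0 = 0 := by simp [wordHeight]

theorem wordHeight_cons_succ (a : Letter) (v : List Letter) (i : ℕ) :
    wordHeight (a :: v) (i + 1) = a.bar + wordHeight v i := by simp [wordHeight]

/-- `pathSum` omits the weight of the final height `0`, whereas the product on the right includes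
it; this accounts for the factor `qInt q 1`, which is `1` only when the denominator `q - q⁻¹` is
nonzero. -/
theorem pathSum_eq_sum (m : ℕ) (h : ℤ) :
    qInt q 1 • pathSum q m h = ∑ v : Fin m → Letter,
      if h + wordHeight (List.ofFn v) m = 0 then
        (∏ i ∈ Finset.range (m + 1), qInt q (1 + (h + wordHeight (List.ofFn v) i))) •
          word q (List.ofFn v)
      else 0 := by
  induction m generalizing h with
  | zero =>
    simp only [pathSum, Finset.univ_unique, List.ofFn_zero, Finset.sum_singleton,
      wordHeight_zero, Finset.prod_range_succ, Finset.range_zero, Finset.prod_empty, add_zero]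
    split_ifs with hh
    · simp [hh, one_def]
    · simp
  | succ m ih =>
    have step : ∀ a : Letter,
        ∑ v : Fin m → Letter, (if h + wordHeight (List.ofFn (Fin.cons a v : Fin (m + 1) → Letter))
            (m + 1) = 0 then
          (∏ i ∈ Finset.range (m + 1 + 1), qInt q (1 + (h + wordHeight
            (List.ofFn (Fin.cons a v : Fin (m + 1) → Letter)) i))) •
              word q (List.ofFn (Fin.cons a v : Fin (m + 1) → Letter)) else 0) =
          qInt q (h + 1) • prepend q a (qInt q 1 • pathSum q m (h + a.bar)) := by
      intro a
      rw [ih, map_sum, Finset.smul_sum]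
      refine Finset.sum_congr rfl fun v _ => ?_
      simp only [List.ofFn_cons, wordHeight_cons_succ, ← add_assoc]
      split_ifs
      · rw [Finset.prod_range_succ']
        simp only [wordHeight_cons_succ, wordHeight_zero, map_smul, prepend_word, smul_smul,
          add_zero, ← add_assoc]
        rw [mul_comm, add_comm 1 h]
      · simp
    rw [sum_fin_succ_letter, step, step, pathSum]
    simp only [Letter.bar, map_smul, ← sub_eq_add_neg]
    module

theorem bar_ge (a : Letter) : -1 ≤ a.bar := by cases a <;> simp [Letter.bar]

/-- A word that goes below height `0` attains the height `-1`. -/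
theorem exists_wordHeight_eq_neg_one (v : List Letter) (h : ℤ) (hh : 0 ≤ h) (i : ℕ)
    (hi : h + wordHeight v i < 0) : ∃ j ≤ i, h + wordHeight v j = -1 := by
  induction i generalizing v h with
  | zero => rw [wordHeight_zero] at hi; omega
  | succ i ih =>
    rcases v with _ | ⟨a, v⟩
    · simp [wordHeight] at hi
      omega
    · rw [wordHeight_cons_succ, ← add_assoc] at hi
      rcases lt_or_ge (h + a.bar) 0 with h1 | h1
      · refine ⟨1, by omega, ?_⟩
        have := bar_ge a
        rw [← zero_add 1, wordHeight_cons_succ, wordHeight_zero]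
        omega
      · obtain ⟨j, hj, e⟩ := ih v (h + a.bar) h1 hi
        exact ⟨j + 1, by omega, by rw [wordHeight_cons_succ]; omega⟩

end QShuffle

section

variable {F : Type*} [Field F] (q : Fˣ)

open QShuffle

theorem qInt_one (hq : (q : F) - (q : F)⁻¹ ≠ 0) : qInt q 1 = 1 := by
  simp [qInt, div_self hq]

theorem catalanElt_eq_heightSum (hq : (q : F) - (q : F)⁻¹ ≠ 0) (n : ℕ) :
    catalanElt q n = heightSum q 0 n := by
  have e := pathSum_eq_sum q (2 * n) 0
  rw [qInt_one q hq, one_smul] at e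
  rw [heightSum_eq q 0 n (2 * n) (by simp) (by omega), e, catalanElt]
  refine Finset.sum_congr rfl fun v _ => ?_
  simp only [zero_add]
  by_cases h1 : wordHeight (List.ofFn v) (2 * n) = 0
  · rw [if_pos h1]
    split_ifs with h2
    · rfl
    -- A word ending at height `0` that is not Catalan goes below `0`, hence attains `-1`, where its
    -- weight has the factor `[0]_q = 0`.
    · have : ∃ i ≤ 2 * n, wordHeight (List.ofFn v) i < 0 := by
        by_contra! hc
        exact h2 ⟨fun i _ hi => hc i (by simpa using hi.le), by simpa using h1⟩
      obtain ⟨i, hi, hneg⟩ := this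
      obtain ⟨j, hj, e⟩ := exists_wordHeight_eq_neg_one (List.ofFn v) 0 le_rfl i (by omega)
      rw [Finset.prod_eq_zero (Finset.mem_range.2 (show j < 2 * n + 1 by omega)), zero_smul]
      rw [show 1 + wordHeight (List.ofFn v) j = 0 by omega, qInt_zero]
  · rw [if_neg h1, if_neg]
    intro h2
    exact h1 (by simpa using h2.2)

end

namespace QShuffle

variable {F : Type*} [Field F] (q : Fˣ)

open PowerSeries

/-! ### Generating functions -/

/-- A linear operator, applied to each coefficient of a power series. -/
noncomputable def mapSeries (L : QShuffle F q →ₗ[F] QShuffle F q) :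
    (QShuffle F q)⟦X⟧ →ₗ[F] (QShuffle F q)⟦X⟧ where
  toFun f := mk fun n => L (coeff n f)
  map_add' f g := by ext n; simp
  map_smul' c f := by
    ext n
    simp

@[simp] theorem coeff_mapSeries (L : QShuffle F q →ₗ[F] QShuffle F q) (f : (QShuffle F q)⟦X⟧)
    (n : ℕ) : coeff n (mapSeries q L f) = L (coeff n f) := by
  simp [mapSeries]

theorem mapSeries_X_mul (L : QShuffle F q →ₗ[F] QShuffle F q) (f : (QShuffle F q)⟦X⟧) :
    mapSeries q L (X * f) = X * mapSeries q L f := by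
  ext n
  rcases n with _ | n <;> simp

/-- The variable is central, so the twisted Leibniz rule holds coefficientwise. -/
theorem mapSeries_deleteFirst_mul (a : Letter) (f g : (QShuffle F q)⟦X⟧) :
    mapSeries q (deleteFirst q a) (f * g) = mapSeries q (deleteFirst q a) f * g +
      mapSeries q (twist q a) f * mapSeries q (deleteFirst q a) g := by
  ext n
  simp [coeff_mul, deleteFirst_mul, Finset.sum_add_distrib]

theorem mul_X_mul (f g : (QShuffle F q)⟦X⟧) : f * (X * g) = X * (f * g) := by
  rw [← mul_assoc, ← mul_assoc, (commute_X f).eq]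

/-- The generating function of the words with weights that start at height `h`. -/
noncomputable def heightSeries (s : F) (h : ℤ) : (QShuffle F q)⟦X⟧ :=
  mk fun n => s ^ n • heightSum q h n

/-- The generating function of the words `xyxy⋯xy`. -/
noncomputable def altXYSeries (u : F) : (QShuffle F q)⟦X⟧ := mk fun n => u ^ n • altXY q n

/-- The generating function of the words `yxy⋯xy`. -/
noncomputable def altYXYSeries (u : F) : (QShuffle F q)⟦X⟧ := mk fun n => u ^ n • altYXY q n

theorem delX_heightSeries (s : F) (h : ℤ) :
    mapSeries q (deleteFirst q Letter.x) (heightSeries q s h) =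
      qInt q (h + 1) • heightSeries q s (h + 1) := by
  ext n
  simp [heightSeries, smul_smul, mul_comm]

theorem delY_heightSeries (s : F) (h : ℤ) :
    mapSeries q (deleteFirst q Letter.y) (heightSeries q s h) =
      (qInt q (h + 1) * s) • (X * heightSeries q s (h - 1)) := by
  ext n
  rcases n with _ | n
  · simp [heightSeries]
  · simp [heightSeries, smul_smul, coeff_succ_X_mul]
    congr 1
    ring

theorem delX_altXYSeries (u : F) :
    mapSeries q (deleteFirst q Letter.x) (altXYSeries q u) = u • (X * altYXYSeries q u) := by
  ext n
  rcases n with _ | n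
  · simp [altXYSeries]
  · have := deleteFirst_x_altXY q (n + 1 : ℕ)
    rw [altXY_natCast, Nat.cast_succ, add_sub_cancel_right] at this
    simp [altXYSeries, altYXYSeries, smul_smul, coeff_succ_X_mul, this,
      pow_succ']

theorem delY_altXYSeries (u : F) :
    mapSeries q (deleteFirst q Letter.y) (altXYSeries q u) = 0 := by
  ext n
  have := deleteFirst_y_altXY q n
  simp at this
  simp [altXYSeries, this]

theorem delX_altYXYSeries (u : F) :
    mapSeries q (deleteFirst q Letter.x) (altYXYSeries q u) = 0 := by
  ext n
  simp [altYXYSeries]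

theorem delY_altYXYSeries (u : F) :
    mapSeries q (deleteFirst q Letter.y) (altYXYSeries q u) = altXYSeries q u := by
  ext n
  simp [altYXYSeries, altXYSeries]

theorem twist_heightSeries (c : Letter) (s : F) (h : ℤ) :
    mapSeries q (twist q c) (heightSeries q s h) =
      (q : F) ^ (-2 * h * c.bar) • heightSeries q s h := by
  ext n
  simp [heightSeries, smul_smul, mul_comm]

theorem twist_altXYSeries (c : Letter) (u : F) :
    mapSeries q (twist q c) (altXYSeries q u) = altXYSeries q u := by
  ext n
  simp [altXYSeries]

theorem twist_altYXYSeries (c : Letter) (u : F) :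
    mapSeries q (twist q c) (altYXYSeries q u) = (q : F) ^ (-2 * c.bar) • altYXYSeries q u := by
  ext n
  simp [altYXYSeries, smul_smul, mul_comm]

/-! ### The two families of products and their equality -/

/-- A family of generating functions that begins with `C(-qt) ⋆ G̃(q²t)`. -/
noncomputable def leftFamily (h : ℤ) : (QShuffle F q)⟦X⟧ :=
  heightSeries q (-q) h * altXYSeries q ((q : F) ^ 2) +
    (q : F) ^ (3 - h) •
      (X * (heightSeries q (-q) (h - 1) * altYXYSeries q ((q : F) ^ 2)))

/-- A family of generating functions that begins with `G̃(q⁻²t) ⋆ C(-q⁻¹t)`. -/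
noncomputable def rightFamily (h : ℤ) : (QShuffle F q)⟦X⟧ :=
  altXYSeries q ((q : F)⁻¹ ^ 2) * heightSeries q (-(q : F)⁻¹) h +
    (q : F) ^ (-1 - h) •
      (X * (altYXYSeries q ((q : F)⁻¹ ^ 2) * heightSeries q (-(q : F)⁻¹) (h - 1)))

theorem sub_inv_ne_zero_iff : (q : F) - (q : F)⁻¹ ≠ 0 ↔ (q : F) ^ 2 - 1 ≠ 0 := by
  have hq0 : (q : F) ≠ 0 := q.ne_zero
  have : (q : F) - (q : F)⁻¹ = ((q : F) ^ 2 - 1) / q := by field_simp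
  rw [this]
  simp

/-- The power `q ^ (3 - h)` in `leftFamily` is chosen so that the mixed terms recombine; after
cancelling powers of `q`, `key` reads `[h+1] = q^(-h) + q[h]`. -/
theorem delX_leftFamily (hq : (q : F) - (q : F)⁻¹ ≠ 0) (h : ℤ) :
    mapSeries q (deleteFirst q Letter.x) (leftFamily q h) =
      qInt q (h + 1) • leftFamily q (h + 1) := by
  have hq0 : (q : F) ≠ 0 := q.ne_zero
  have hp : (q : F) ^ h ≠ 0 := zpow_ne_zero _ hq0
  have hq1 := (sub_inv_ne_zero_iff q).1 hq
  have hh : h - 1 + 1 = h := by ring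
  have hh' : h + 1 - 1 = h := by ring
  simp only [leftFamily, map_add, map_smul, mapSeries_X_mul, mapSeries_deleteFirst_mul,
    delX_heightSeries, delX_altXYSeries, delX_altYXYSeries, twist_heightSeries, Letter.bar,
    smul_mul_assoc, mul_smul_comm, mul_X_mul, mul_zero, add_zero, hh, hh', smul_add, smul_smul]
  have key : (q : F) ^ 2 * (q : F) ^ (-2 * h * 1) + (q : F) ^ (3 - h) * qInt q h =
      qInt q (h + 1) * (q : F) ^ (3 - (h + 1)) := by
    have e : (q : F) ^ (-2 * h * 1) = ((q : F) ^ h)⁻¹ ^ 2 := by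
      rw [← zpow_neg, ← zpow_natCast, ← zpow_mul]; congr 1; push_cast; ring
    simp only [qInt, e, zpow_sub₀ hq0, zpow_add₀ hq0, zpow_neg, zpow_ofNat]
    field_simp
    ring
  linear_combination (norm := module)
    key • (X * (heightSeries q (-q) h * altYXYSeries q ((q : F) ^ 2)))

/-- Here `key` is the companion rule `[h+1] = q^h + q⁻¹[h]`. On the right family the two rules
exchange roles, and the resulting deletion formulas are identical. -/
theorem delY_leftFamily (hq : (q : F) - (q : F)⁻¹ ≠ 0) (h : ℤ) :
    mapSeries q (deleteFirst q Letter.y) (leftFamily q h) =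
      (-qInt q h) • (X * leftFamily q (h - 1)) := by
  have hq0 : (q : F) ≠ 0 := q.ne_zero
  have hp : (q : F) ^ h ≠ 0 := zpow_ne_zero _ hq0
  have hq1 := (sub_inv_ne_zero_iff q).1 hq
  have hh : h - 1 + 1 = h := by ring
  simp only [leftFamily, map_add, map_smul, mapSeries_X_mul, mapSeries_deleteFirst_mul,
    delY_heightSeries, delY_altXYSeries, delY_altYXYSeries, twist_heightSeries, Letter.bar,
    smul_mul_assoc, mul_smul_comm, mul_assoc X, mul_add, mul_zero, add_zero, hh, smul_add,
    smul_smul]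
  have key : qInt q (h + 1) * -(q : F) + (q : F) ^ (3 - h) * (q : F) ^ (-2 * (h - 1) * -1) =
      -qInt q h := by
    have e : (q : F) ^ (3 - h) * (q : F) ^ (-2 * (h - 1) * -1) = (q : F) ^ h * q := by
      rw [← zpow_add₀ hq0, ← zpow_add_one₀ hq0]; congr 1; ring
    simp only [e, qInt, zpow_add₀ hq0, zpow_neg, zpow_one]
    field_simp
    ring
  have key' : (q : F) ^ (3 - h) * (qInt q h * -(q : F)) = -qInt q h * (q : F) ^ (3 - (h - 1)) := by
    rw [show 3 - (h - 1) = 3 - h + 1 by ring, zpow_add_one₀ hq0]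
    ring
  linear_combination (norm := module)
    key • (X * (heightSeries q (-q) (h - 1) * altXYSeries q ((q : F) ^ 2))) +
    key' • (X * (X * (heightSeries q (-q) (h - 1 - 1) * altYXYSeries q ((q : F) ^ 2))))

theorem delX_rightFamily (hq : (q : F) - (q : F)⁻¹ ≠ 0) (h : ℤ) :
    mapSeries q (deleteFirst q Letter.x) (rightFamily q h) =
      qInt q (h + 1) • rightFamily q (h + 1) := by
  have hq0 : (q : F) ≠ 0 := q.ne_zero
  have hp : (q : F) ^ h ≠ 0 := zpow_ne_zero _ hq0
  have hq1 := (sub_inv_ne_zero_iff q).1 hq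
  have hh : h - 1 + 1 = h := by ring
  have hh' : h + 1 - 1 = h := by ring
  simp only [rightFamily, map_add, map_smul, mapSeries_X_mul, mapSeries_deleteFirst_mul,
    delX_heightSeries, delX_altXYSeries, delX_altYXYSeries, twist_altXYSeries,
    twist_altYXYSeries, Letter.bar, smul_mul_assoc, mul_smul_comm, mul_assoc X, zero_mul,
    zero_add, hh, hh', smul_add, smul_smul]
  have key : (q : F)⁻¹ ^ 2 + (q : F) ^ (-1 - h) * (qInt q h * (q : F) ^ (-2 * 1 : ℤ)) =
      qInt q (h + 1) * (q : F) ^ (-1 - (h + 1)) := by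
    have e : (q : F) ^ (-2 * 1 : ℤ) = (q : F)⁻¹ ^ 2 := by
      rw [mul_one, zpow_neg, inv_pow, zpow_ofNat]
    simp only [qInt, e, zpow_sub₀ hq0, zpow_add₀ hq0, zpow_neg, zpow_one]
    field_simp
    ring
  linear_combination (norm := module)
    key • (X * (altYXYSeries q ((q : F)⁻¹ ^ 2) * heightSeries q (-(q : F)⁻¹) h))

theorem delY_rightFamily (hq : (q : F) - (q : F)⁻¹ ≠ 0) (h : ℤ) :
    mapSeries q (deleteFirst q Letter.y) (rightFamily q h) =
      (-qInt q h) • (X * rightFamily q (h - 1)) := by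
  have hq0 : (q : F) ≠ 0 := q.ne_zero
  have hp : (q : F) ^ h ≠ 0 := zpow_ne_zero _ hq0
  have hq1 := (sub_inv_ne_zero_iff q).1 hq
  have hh : h - 1 + 1 = h := by ring
  simp only [rightFamily, map_add, map_smul, mapSeries_X_mul, mapSeries_deleteFirst_mul,
    delY_heightSeries, delY_altXYSeries, delY_altYXYSeries, twist_altXYSeries,
    twist_altYXYSeries, Letter.bar, smul_mul_assoc, mul_smul_comm, mul_X_mul, mul_add, zero_mul,
    zero_add, hh, smul_add, smul_smul]
  have key : qInt q (h + 1) * -(q : F)⁻¹ + (q : F) ^ (-1 - h) = -qInt q h := by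
    simp only [qInt, zpow_sub₀ hq0, zpow_add₀ hq0, zpow_neg, zpow_one]
    field_simp
    ring
  have key' : (q : F) ^ (-1 - h) * (qInt q h * -(q : F)⁻¹ * (q : F) ^ (-2 * -1 : ℤ)) =
      -qInt q h * (q : F) ^ (-1 - (h - 1)) := by
    have e : (q : F) ^ (-2 * -1 : ℤ) = (q : F) ^ 2 := by norm_num
    rw [show -1 - (h - 1) = -1 - h + 1 by ring, zpow_add_one₀ hq0, e]
    field_simp
  linear_combination (norm := module)
    key • (X * (altXYSeries q ((q : F)⁻¹ ^ 2) * heightSeries q (-(q : F)⁻¹) (h - 1))) +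
    key' • (X * (X * (altYXYSeries q ((q : F)⁻¹ ^ 2) * heightSeries q (-(q : F)⁻¹) (h - 1 - 1))))

theorem map_constTerm_heightSeries (s : F) (h : ℤ) :
    PowerSeries.map (constTerm q) (heightSeries q s h) = if h = 0 then 1 else 0 := by
  ext n
  rcases n with _ | n <;> split_ifs with hh <;> simp [heightSeries, hh, coeff_one]

theorem map_constTerm_altXYSeries (u : F) :
    PowerSeries.map (constTerm q) (altXYSeries q u) = 1 := by
  ext n
  have := constTerm_altXY q n
  simp only [altXYSeries, coeff_map, coeff_mk, constTerm_smul, this, coeff_one]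
  rcases n with _ | n <;> simp
  omega

theorem map_constTerm_altYXYSeries (u : F) :
    PowerSeries.map (constTerm q) (altYXYSeries q u) = 0 := by
  ext n
  simp [altYXYSeries]

theorem map_constTerm_smul (c : F) (f : (QShuffle F q)⟦X⟧) :
    PowerSeries.map (constTerm q) (c • f) = c • PowerSeries.map (constTerm q) f := by
  ext n
  simp

/-- All coefficients at all heights are treated together, since deletion shifts `h` and the degree.
Both constant terms are `1` at `h = 0` and `0` elsewhere, so the differences satisfy the vanishing
criterion. -/
theorem leftFamily_eq_rightFamily (hq : (q : F) - (q : F)⁻¹ ≠ 0) (h : ℤ) :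
    leftFamily q h = rightFamily q h := by
  ext n
  rw [← sub_eq_zero, ← map_sub]
  refine family_eq_zero q
    (fun k : ℤ × ℕ => coeff k.2 (leftFamily q k.1 - rightFamily q k.1)) ?_ ?_ (h, n)
  · rintro ⟨h, n⟩
    have : PowerSeries.map (constTerm q) (leftFamily q h - rightFamily q h) = 0 := by
      simp only [leftFamily, rightFamily, map_sub, map_add, map_constTerm_smul, map_mul, map_X,
        map_constTerm_heightSeries, map_constTerm_altXYSeries, map_constTerm_altYXYSeries]
      simp
    simpa using congrArg (coeff n) this
  · rintro a ⟨h, n⟩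
    simp only [← coeff_mapSeries, map_sub]
    cases a
    · rw [delX_leftFamily q hq, delX_rightFamily q hq]
      convert Submodule.smul_mem _ (qInt q (h + 1))
        (Submodule.subset_span (Set.mem_range_self (h + 1, n))) using 1
      simp [smul_sub]
    · rw [delY_leftFamily q hq, delY_rightFamily q hq]
      rcases n with _ | n
      · simp
      · convert Submodule.smul_mem _ (-qInt q h)
          (Submodule.subset_span (Set.mem_range_self (h - 1, n))) using 1
        simp [coeff_succ_X_mul, sub_eq_add_neg, add_comm]

theorem heightSeries_mul_altXYSeries (hq : (q : F) - (q : F)⁻¹ ≠ 0) :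
    heightSeries q (-q) 0 * altXYSeries q ((q : F) ^ 2) =
      altXYSeries q ((q : F)⁻¹ ^ 2) * heightSeries q (-(q : F)⁻¹) 0 := by
  -- At `h = 0` the correction terms of both families involve height `-1` and disappear.
  have e : ∀ s : F, heightSeries q s (-1) = 0 := by
    intro s
    ext n
    simp [heightSeries, heightSum_of_neg]
  simpa [leftFamily, rightFamily, e] using leftFamily_eq_rightFamily q hq 0

end QShuffle

open QShuffle PowerSeries in
/-- The coefficients of `C(-qt) ⋆ G̃(q²t) = G̃(q⁻²t) ⋆ C(-q⁻¹t)`. -/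
theorem sum_catalanElt_mul_tildeG {F : Type*} [Field F] (q : Fˣ)
    (hq : (q : F) - (q : F)⁻¹ ≠ 0) (n : ℕ) :
    ∑ i ∈ Finset.range (n + 1),
        ((-1) ^ i * (q : F) ^ (2 * (n : ℤ) - i)) • (catalanElt q i * tildeG q (n - i)) =
      ∑ i ∈ Finset.range (n + 1),
        ((-1) ^ i * (q : F) ^ (-(2 * (n : ℤ) - i))) • (tildeG q (n - i) * catalanElt q i) := by
  have hq0 : (q : F) ≠ 0 := q.ne_zero
  have e := congrArg (coeff n) (heightSeries_mul_altXYSeries q hq)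
  -- The swap makes `i` the index of the Catalan factor on both sides.
  rw [coeff_mul, coeff_mul, Finset.Nat.sum_antidiagonal_eq_sum_range_succ_mk,
    ← Finset.Nat.sum_antidiagonal_swap, Finset.Nat.sum_antidiagonal_eq_sum_range_succ_mk] at e
  simp only [Prod.swap, heightSeries, altXYSeries, coeff_mk, altXY_natCast,
    ← catalanElt_eq_heightSum q hq, smul_mul_assoc, mul_smul_comm, smul_smul] at e
  convert e using 2 with i hi i hi
  · have : 2 * (n : ℤ) - i = ((i + 2 * (n - i) : ℕ) : ℤ) := by
      have := Finset.mem_range.1 hi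
      omega
    rw [this, zpow_natCast, neg_pow]
    congr 1
    ring
  · have : 2 * (n : ℤ) - i = ((i + 2 * (n - i) : ℕ) : ℤ) := by
      have := Finset.mem_range.1 hi
      omega
    rw [this, zpow_neg, zpow_natCast, neg_pow, ← inv_pow]
    congr 1
    ring

/-! ### The generated subalgebras -/

section Generation

variable {F : Type*} [Field F] (q : Fˣ)

open QShuffle

/-- The subalgebra generated by the terms of a sequence from index `1` on. -/
noncomputable abbrev adjoinSeq (a : ℕ → QShuffle F q) : Subalgebra F (QShuffle F q) :=
  Algebra.adjoin F {b | ∃ n : ℕ, 1 ≤ n ∧ b = a n}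

theorem mem_adjoinSeq (a : ℕ → QShuffle F q) (h0 : a 0 = 1) (n : ℕ) : a n ∈ adjoinSeq q a := by
  rcases n with _ | n
  · rw [h0]; exact one_mem _
  · exact Algebra.subset_adjoin ⟨n + 1, by omega, rfl⟩

theorem adjoinSeq_le {a : ℕ → QShuffle F q} {S : Subalgebra F (QShuffle F q)}
    (h : ∀ n, a n ∈ S) : adjoinSeq q a ≤ S :=
  Algebra.adjoin_le (by rintro _ ⟨n, _, rfl⟩; exact h n)

theorem catalanElt_zero (hq : (q : F) - (q : F)⁻¹ ≠ 0) : catalanElt q 0 = 1 := by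
  rw [catalanElt_eq_heightSum q hq, heightSum_eq q 0 0 0 (by simp) (by omega), pathSum, if_pos rfl]

theorem zpow_sub_zpow_neg_ne_zero (hq : ∀ m : ℕ, 1 ≤ m → q ^ m ≠ 1) (n : ℕ) (hn : 1 ≤ n) :
    (q : F) ^ (n : ℤ) - (q : F) ^ (-(n : ℤ)) ≠ 0 := by
  intro h
  apply hq (2 * n) (by omega)
  have hp : (q : F) ^ n ≠ 0 := pow_ne_zero _ q.ne_zero
  rw [zpow_neg, zpow_natCast, sub_eq_zero, ← mul_eq_one_iff_eq_inv₀ hp, ← pow_add, ← two_mul] at h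
  exact Units.ext (by simpa using h)

theorem sub_inv_ne_zero (hq : ∀ m : ℕ, 1 ≤ m → q ^ m ≠ 1) : (q : F) - (q : F)⁻¹ ≠ 0 := by
  simpa using zpow_sub_zpow_neg_ne_zero q hq 1 le_rfl

theorem qInt_ne_zero (hq : ∀ m : ℕ, 1 ≤ m → q ^ m ≠ 1) (n : ℕ) (hn : 1 ≤ n) :
    qInt q n ≠ 0 :=
  div_ne_zero (zpow_sub_zpow_neg_ne_zero q hq n hn) (sub_inv_ne_zero q hq)

theorem mem_of_smul_mem {S : Subalgebra F (QShuffle F q)} {c : F} (hc : c ≠ 0)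
    {f : QShuffle F q} (h : c • f ∈ S) : f ∈ S := by
  simpa [smul_smul, hc] using S.smul_mem h c⁻¹

/-- Since `G̃_0 = 1`, the terms `i = n` of the two sums differ by `(-1)^n (q^n - q^(-n)) C_n`, with
nonzero coefficient, and all other terms involve earlier `C_i`. No commutation is needed yet. -/
theorem catalanElt_mem_adjoin_tildeG (hq : ∀ m : ℕ, 1 ≤ m → q ^ m ≠ 1) (n : ℕ) :
    catalanElt q n ∈ adjoinSeq q (tildeG q) := by
  have hq1 := sub_inv_ne_zero q hq
  induction n using Nat.strong_induction_on with
  | _ n ih =>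
    rcases Nat.eq_zero_or_pos n with rfl | hn
    · rw [catalanElt_zero q hq1]
      exact one_mem _
    have e := sum_catalanElt_mul_tildeG q hq1 n
    rw [Finset.sum_range_succ, Finset.sum_range_succ, Nat.sub_self, tildeG_zero, mul_one,
      one_mul] at e
    have hz := zpow_sub_zpow_neg_ne_zero q hq n hn
    have hsgn : ((-1 : F) ^ n) ≠ 0 := pow_ne_zero _ (by simp)
    apply mem_of_smul_mem q (mul_ne_zero hsgn hz)
    have hG := mem_adjoinSeq q (tildeG q) rfl
    have hsum : ∀ c : ℕ → F, ∑ i ∈ Finset.range n, c i • (catalanElt q i * tildeG q (n - i)) ∈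
        adjoinSeq q (tildeG q) := fun c => sum_mem fun i hi =>
      Subalgebra.smul_mem _ (mul_mem (ih i (Finset.mem_range.1 hi)) (hG _)) _
    have hsum' : ∀ c : ℕ → F, ∑ i ∈ Finset.range n, c i • (tildeG q (n - i) * catalanElt q i) ∈
        adjoinSeq q (tildeG q) := fun c => sum_mem fun i hi =>
      Subalgebra.smul_mem _ (mul_mem (hG _) (ih i (Finset.mem_range.1 hi))) _
    convert sub_mem (hsum' fun i => (-1) ^ i * (q : F) ^ (-(2 * (n : ℤ) - i)))
      (hsum fun i => (-1) ^ i * (q : F) ^ (2 * (n : ℤ) - i)) using 1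
    rw [show 2 * (n : ℤ) - n = n by ring] at e
    linear_combination (norm := module) e

/-- The centralizer of `G̃_n` is a subalgebra containing every `G̃_k`, hence every `C_m`. -/
theorem catalanElt_commute_tildeG (hq : ∀ m : ℕ, 1 ≤ m → q ^ m ≠ 1) (m n : ℕ) :
    Commute (catalanElt q m) (tildeG q n) := by
  have h : adjoinSeq q (tildeG q) ≤ Subalgebra.centralizer F {tildeG q n} :=
    adjoinSeq_le q fun k => by
      rw [Subalgebra.mem_centralizer_iff]
      rintro _ rfl
      exact tildeG_commute q n k
  have := h (catalanElt_mem_adjoin_tildeG q hq m)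
  rw [Subalgebra.mem_centralizer_iff] at this
  exact (this _ rfl).symm

theorem sum_qInt_smul_catalanElt_mul_tildeG (hq : ∀ m : ℕ, 1 ≤ m → q ^ m ≠ 1) (n : ℕ) :
    (0 : QShuffle F q) = ∑ i ∈ Finset.range (n + 1),
      ((-1 : F) ^ i * qInt q (2 * (n : ℤ) - (i : ℤ))) •
        (catalanElt q i * tildeG q (n - i)) := by
  have e := sum_catalanElt_mul_tildeG q (sub_inv_ne_zero q hq) n
  rw [← sub_eq_zero, ← Finset.sum_sub_distrib] at e
  -- Dividing the difference of the two sums by `q - q⁻¹` turns `q^(2n-i) - q^(-(2n-i))` into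
  -- `[2n-i]_q`.
  rw [← smul_zero ((q : F) - (q : F)⁻¹)⁻¹, ← e, Finset.smul_sum]
  refine Finset.sum_congr rfl fun i _ => ?_
  rw [← (catalanElt_commute_tildeG q hq i (n - i)).eq, ← sub_smul, smul_smul, qInt]
  congr 1
  ring

/-- For the reverse inclusion, the term `i = 0` of the relation is `[2n]_q G̃_n`, with `[2n]_q ≠ 0`
for `n ≥ 1`; the rest involves only earlier `G̃_k` and the `C_i`. -/
theorem adjoin_catalanElt (hq : ∀ m : ℕ, 1 ≤ m → q ^ m ≠ 1) :
    adjoinSeq q (catalanElt q) = adjoinSeq q (tildeG q) := by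
  have h0 := catalanElt_zero q (sub_inv_ne_zero q hq)
  refine le_antisymm (adjoinSeq_le q (catalanElt_mem_adjoin_tildeG q hq))
    (adjoinSeq_le q fun n => ?_)
  induction n using Nat.strong_induction_on with
  | _ n ih =>
    rcases Nat.eq_zero_or_pos n with rfl | hn
    · exact one_mem _
    have e := sum_qInt_smul_catalanElt_mul_tildeG q hq n
    rw [Finset.sum_range_succ', h0, one_mul, pow_zero, one_mul, Nat.cast_zero, sub_zero,
      Nat.sub_zero] at e
    have hz := qInt_ne_zero q hq (2 * n) (by omega)
    push_cast at hz
    apply mem_of_smul_mem q hz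
    rw [eq_neg_of_add_eq_zero_right e.symm]
    exact neg_mem (sum_mem fun i hi => Subalgebra.smul_mem _
      (mul_mem (mem_adjoinSeq q _ h0 _) (ih _ (by omega))) _)

/-- In the recursion both `D_n` and `G̃_n` have coefficient `1`, so either can be isolated, for any
nonzero `q`. -/
theorem adjoin_dElt : adjoinSeq q (dElt q) = adjoinSeq q (tildeG q) := by
  have h0 : dElt q 0 = 1 := by rw [dElt]
  apply le_antisymm
  · refine adjoinSeq_le q fun n => ?_
    induction n using Nat.strong_induction_on with
    | _ n ih =>
      rcases Nat.eq_zero_or_pos n with rfl | hn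
      · rw [h0]
        exact one_mem _
      have e := sum_dElt_mul_tildeG q n hn
      rw [Finset.sum_range_succ, Nat.sub_self, tildeG_zero, mul_one] at e
      rw [eq_neg_of_add_eq_zero_right e]
      exact neg_mem (sum_mem fun i hi =>
        mul_mem (ih i (Finset.mem_range.1 hi)) (mem_adjoinSeq q _ rfl _))
  · refine adjoinSeq_le q fun n => ?_
    induction n using Nat.strong_induction_on with
    | _ n ih =>
      rcases Nat.eq_zero_or_pos n with rfl | hn
      · exact one_mem _
      have e := sum_dElt_mul_tildeG q n hn
      rw [Finset.sum_range_succ', h0, one_mul, Nat.sub_zero] at e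
      rw [eq_neg_of_add_eq_zero_right e]
      exact neg_mem (sum_mem fun i hi =>
        mul_mem (mem_adjoinSeq q _ h0 _) (ih _ (by omega)))

end Generation

theorem theorem11p15 {F : Type*} [Field F] (q : Fˣ) (hq : ∀ m : ℕ, 1 ≤ m → q ^ m ≠ 1) :
    (∀ n : ℕ, (0 : QShuffle F q) =
      ∑ i ∈ Finset.range (n + 1),
        ((-1 : F) ^ i * qInt q (2 * (n : ℤ) - (i : ℤ))) •
          (catalanElt q i * tildeG q (n - i))) ∧
    Algebra.adjoin F {a : QShuffle F q | ∃ n : ℕ, 1 ≤ n ∧ a = catalanElt q n} =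
      Algebra.adjoin F {a : QShuffle F q | ∃ n : ℕ, 1 ≤ n ∧ a = dElt q n} ∧
    Algebra.adjoin F {a : QShuffle F q | ∃ n : ℕ, 1 ≤ n ∧ a = dElt q n} =
      Algebra.adjoin F {a : QShuffle F q | ∃ n : ℕ, 1 ≤ n ∧ a = tildeG q n} :=
  ⟨sum_qInt_smul_catalanElt_mul_tildeG q hq,
    (adjoin_catalanElt q hq).trans (adjoin_dElt q).symm, adjoin_dElt q⟩
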